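/- Let $f$ be one of the functions $e^{x}$, $\ln x$, $\sin x$, $\cos x$, $\tan x$, $\csc x$, $\sec x$, $\cot x$, $\sinh x$, $\cosh x$, $\tanh x$, $\coth x$ of a complex variable, where $\ln$ denotes the principal branch on $\mathbb{C}\setminus\{0\}$, and let $g,h_1,h_2\in\mathbb{Q}[x]$. Let $\alpha\in\mathbb{C}$ be a zero of the equation $$h_1(x)\,f(g(x))=h_2(x),$$ that is, $f$ is defined at $g(\alpha)$ and $h_1(\alpha)f(g(\alpha))=h_2(\alpha)$. Assume that $h_1(\alpha)\neq 0$ and $g(\alpha)\neq 0$ and, if $f=\ln$, that also $g(\alpha)\neq 1$. Then $\alpha$ is transcendental over $\mathbb{Q}$. (In particular, taking $f(x)=e^x$ and $h_1=1$: every complex zero $\alpha$ of $e^{g(x)}=h_2(x)$ with $g(\alpha)\neq 0$ is transcendental.) -/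

import Mathlib

open scoped Polynomial

/-- Names for the twelve functions `exp, ln, sin, cos, tan, csc, sec, cot, sinh, cosh, tanh, coth`. -/
inductive ClassicalFun where
  | exp | ln | sin | cos | tan | csc | sec | cot | sinh | cosh | tanh | coth

namespace ClassicalFun

/-- The set of complex numbers at which the function is defined. -/
def domain : ClassicalFun → Set ℂ
  | exp => Set.univ
  | ln => {z | z ≠ 0}
  | sin => Set.univ
  | cos => Set.univ
  | tan => {z | Complex.cos z ≠ 0}
  | csc => {z | Complex.sin z ≠ 0}
  | sec => {z | Complex.cos z ≠ 0}
  | cot => {z | Complex.sin z ≠ 0}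
  | sinh => Set.univ
  | cosh => Set.univ
  | tanh => {z | Complex.cosh z ≠ 0}
  | coth => {z | Complex.sinh z ≠ 0}

/-- The value of the function at a complex number of its domain; `ln` is the principal branch,
which is the real logarithm on the positive reals. -/
noncomputable def eval : ClassicalFun → ℂ → ℂ
  | exp, z => Complex.exp z
  | ln, z => Complex.log z
  | sin, z => Complex.sin z
  | cos, z => Complex.cos z
  | tan, z => Complex.sin z / Complex.cos z
  | csc, z => 1 / Complex.sin z
  | sec, z => 1 / Complex.cos z
  | cot, z => Complex.cos z / Complex.sin z
  | sinh, z => Complex.sinh z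
  | cosh, z => Complex.cosh z
  | tanh, z => Complex.sinh z / Complex.cosh z
  | coth, z => Complex.cosh z / Complex.sinh z

end ClassicalFun

/-!
The theorem rests on the Hermite–Lindemann theorem `transcendental_exp`: `exp z` is transcendental
for algebraic `z ≠ 0`. If `α` were algebraic, then `z = g(α)` and
`f(z) = h₂(α) / h₁(α)` would be algebraic too. But `f(z)` is transcendental
(`ClassicalFun.transcendental_eval`): for `ln`, apply Hermite–Lindemann to `ln z ≠ 0`, whose
exponential is `z`; for the others, an algebraic value of `f` at `z` would make `exp z` or
`exp (i z)` algebraic, by `cosh² - sinh² = 1`.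

Mathlib has the analytic half of Hermite–Lindemann, good simultaneous approximations of the
exponentials of the roots of an integer polynomial. The arithmetic half is proved here, not
for general exponential sums with algebraic coefficients but for those in a Galois number field
whose coefficients are Galois-equivariant in the exponents: such a sum cannot vanish if its
constant term is nonzero (`coeff_zero_eq_zero_of_sum_exp_eq_zero`). A relation
`exp a = b` between algebraic numbers is turned into such a sum in the group algebra `K[K]`, by
multiplying the conjugates of `e^a - b` and then averaging a translate of the product
(`exp_ne_of_isGalois`).
-/

/-! ### Equivariant exponential sums -/

/-- The leading coefficient of a polynomial that kills `x` is a denominator of `x`, so its `m`-th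
power is a denominator of every polynomial expression in `x` of degree at most `m`. -/
theorem isIntegral_leadingCoeff_pow_smul_aeval {R S : Type*} [CommRing R] [CommRing S] [Algebra R S]
    {f : R[X]} {x : S} (hx : Polynomial.aeval x f = 0) (q : R[X]) {m : ℕ} (hm : q.natDegree ≤ m) :
    IsIntegral R (f.leadingCoeff ^ m • Polynomial.aeval x q) := by
  rw [Polynomial.aeval_eq_sum_range, Finset.smul_sum]
  refine IsIntegral.sum _ fun i hi ↦ ?_
  have hi' : i ≤ m := (Nat.lt_succ_iff.mp (Finset.mem_range.mp hi)).trans hm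
  have h : f.leadingCoeff ^ m • q.coeff i • x ^ i =
      (f.leadingCoeff ^ (m - i) * q.coeff i) • (f.leadingCoeff • x) ^ i := by
    rw [smul_pow, smul_smul, smul_smul]
    congr 1
    rw [← Nat.sub_add_cancel hi', pow_add, Nat.add_sub_cancel]
    ring
  rw [h]
  exact ((isIntegral_leadingCoeff_smul f x hx).pow i).smul _

theorem exists_int_polynomial_aeval_eq_zero {K : Type*} [Field K] [NumberField K]
    (s : Finset K) (hs : 0 ∉ s) :
    ∃ f : ℤ[X], f.eval 0 ≠ 0 ∧ ∀ x ∈ s, Polynomial.aeval x f = 0 := by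
  have h (x : K) (hx : x ≠ 0) : ∃ q : ℤ[X], q.coeff 0 ≠ 0 ∧ Polynomial.aeval x q = 0 :=
    ((IsFractionRing.isAlgebraic_iff ℤ ℚ K).mpr
      (Algebra.IsAlgebraic.isAlgebraic x)).exists_nonzero_coeff_and_aeval_eq_zero
      (mem_nonZeroDivisors_of_ne_zero hx)
  choose! q hq₀ hq using h
  have hne {x} (hx : x ∈ s) : x ≠ 0 := ne_of_mem_of_not_mem hx hs
  refine ⟨∏ x ∈ s, q x, ?_, fun x hx ↦ ?_⟩
  · rw [Polynomial.eval_prod]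
    refine Finset.prod_ne_zero_iff.mpr fun x hx ↦ ?_
    rw [← Polynomial.coeff_zero_eq_eval_zero]
    exact hq₀ x (hne hx)
  · rw [map_prod]
    exact Finset.prod_eq_zero hx (hq x (hne hx))

theorem exists_int_eq_of_forall_gal_fixed {K : Type*} [Field K] [NumberField K] [IsGalois ℚ K]
    {x : K} (hx : IsIntegral ℤ x) (hfix : ∀ σ : Gal(K/ℚ), σ x = x) : ∃ n : ℤ, (n : K) = x := by
  obtain ⟨q, rfl⟩ := (IsGalois.mem_range_algebraMap_iff_fixed x).mpr hfix
  rw [isIntegral_algebraMap_iff (algebraMap ℚ K).injective] at hx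
  obtain ⟨n, rfl⟩ := IsIntegrallyClosed.isIntegral_iff.mp hx
  exact ⟨n, by simp⟩

theorem tendsto_const_mul_pow_mul_pow_div_factorial_pred (A B c : ℝ) :
    Filter.Tendsto (fun p : ℕ ↦ A * B ^ p * (c ^ p / (p - 1).factorial)) Filter.atTop (nhds 0) := by
  rw [← Filter.tendsto_add_atTop_iff_nat 1]
  have h := (FloorSemiring.tendsto_pow_div_factorial_atTop (B * c)).const_mul (A * (B * c))
  rw [mul_zero] at h
  refine h.congr fun m ↦ ?_
  rw [Nat.add_sub_cancel, mul_pow, pow_succ, pow_succ]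
  ring

/-- The arithmetic core of the Hermite–Lindemann theorem: if a finite sum `∑ c x * exp x` over a
Galois number field vanishes and its coefficients satisfy `c (σ x) = σ (c x)`, then the coefficient
of `exp 0` is zero. For a large prime `p`, the simultaneous approximations `n * exp x ≈ p * g x` of
`LindemannWeierstrass.exp_polynomial_approx` make `n * c 0 + p * ∑ c x * g x` (the sum over `x ≠ 0`)
tiny. After denominators are cleared it is an algebraic integer, and the Galois symmetry makes it
rational, hence an integer; it is not divisible by `p` unless `c 0 = 0`. -/
theorem coeff_zero_eq_zero_of_sum_exp_eq_zero {K : Type*} [Field K] [NumberField K] [IsGalois ℚ K]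
    (φ : K →+* ℂ) (c : K →₀ K) (hc : ∀ (σ : Gal(K/ℚ)) (x : K), c (σ x) = σ (c x))
    (hsum : c.sum (fun x a ↦ φ a * Complex.exp (φ x)) = 0) : c 0 = 0 := by
  classical
  by_contra h0
  set s := c.support.erase 0 with hs
  obtain ⟨f, hf0, hf⟩ := exists_int_polynomial_aeval_eq_zero s (Finset.notMem_erase 0 _)
  have hfne : f ≠ 0 := by rintro rfl; simp at hf0
  obtain ⟨D, hD, hDint⟩ := exists_integral_multiples ℤ ℚ (c.support.image c)
  have hDint' (x : K) : IsIntegral ℤ (D • c x) := by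
    by_cases hx : c x = 0
    · rw [hx, smul_zero]; exact isIntegral_zero
    · exact hDint _ (Finset.mem_image_of_mem c (Finsupp.mem_support_iff.mpr hx))
  have hc0 (σ : Gal(K/ℚ)) : σ (c 0) = c 0 := by rw [← hc, map_zero]
  obtain ⟨N, hN⟩ := exists_int_eq_of_forall_gal_fixed (hDint' 0) fun σ ↦ by rw [map_zsmul, hc0]
  have hN0 : N ≠ 0 := by
    rintro rfl
    rw [Int.cast_zero, eq_comm, smul_eq_zero] at hN
    exact hN.elim hD h0
  obtain ⟨C, hC⟩ := LindemannWeierstrass.exp_polynomial_approx f hf0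
  set a := f.leadingCoeff with ha
  have ha0 : a ≠ 0 := Polynomial.leadingCoeff_ne_zero.mpr hfne
  set d := f.natDegree with hd
  -- `p` exceeds everything it must not divide, and is so large that the factorial beats the cost
  -- `a ^ (p * d)` of clearing the denominators.
  obtain ⟨p, hpp, hpf, hpa, hpN, hlt⟩ : ∃ p : ℕ, p.Prime ∧ (f.eval 0).natAbs < p ∧ a.natAbs < p ∧
      N.natAbs < p ∧ (|(D : ℝ)| * ∑ x ∈ s, ‖φ (c x)‖) * (|(a : ℝ)| ^ d) ^ p *
        (C ^ p / (p - 1).factorial) < 1 := by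
    have hev := ((tendsto_const_mul_pow_mul_pow_div_factorial_pred
      (|(D : ℝ)| * ∑ x ∈ s, ‖φ (c x)‖) (|(a : ℝ)| ^ d) C).eventually_lt_const one_pos).and
      ((Filter.eventually_gt_atTop (f.eval 0).natAbs).and
      ((Filter.eventually_gt_atTop a.natAbs).and (Filter.eventually_gt_atTop N.natAbs)))
    obtain ⟨p, ⟨h1, h2, h3, h4⟩, hp⟩ :=
      (hev.and_frequently (Nat.frequently_atTop_iff_infinite.mpr Nat.infinite_setOfPred_prime)).exists
    exact ⟨p, hp, h2, h3, h4, h1⟩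
  obtain ⟨n, hn, g, hgdeg, hg⟩ := hC p hpf hpp
  have hg' (x : K) (hx : x ∈ s) : ‖(n : ℂ) * Complex.exp (φ x) - p * φ (Polynomial.aeval x g)‖ ≤
      C ^ p / (p - 1).factorial := by
    have hroot : φ x ∈ f.aroots ℂ := by
      rw [Polynomial.mem_aroots]
      refine ⟨hfne, ?_⟩
      have := Polynomial.aeval_algHom_apply φ.toIntAlgHom x f
      simpa [hf x hx] using this
    have h2 : Polynomial.aeval (φ x) g = φ (Polynomial.aeval x g) :=
      Polynomial.aeval_algHom_apply φ.toIntAlgHom x g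
    simpa [h2] using hg hroot
  -- `σ` permutes the terms of the sum, because both factors are equivariant in `x`.
  obtain ⟨M, hM⟩ : ∃ M : ℤ, (M : K) = ∑ x ∈ s, (D • c x) * (a ^ (p * d) • Polynomial.aeval x g) := by
    refine exists_int_eq_of_forall_gal_fixed ?_ fun σ ↦ ?_
    · refine IsIntegral.sum _ fun x hx ↦ (hDint' x).mul ?_
      exact isIntegral_leadingCoeff_pow_smul_aeval (hf x hx) g (hgdeg.trans (Nat.sub_le _ _))
    · rw [map_sum]
      refine Finset.sum_bij (fun x _ ↦ σ x) (fun x hx ↦ ?_) (fun x _ y _ h ↦ σ.injective h)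
        (fun y hy ↦ ⟨σ.symm y, ?_, by simp⟩) fun x hx ↦ ?_
      · simpa [hs, hc] using hx
      · have := hc σ (σ.symm y)
        rw [AlgEquiv.apply_symm_apply] at this
        simpa [hs, this] using hy
      · rw [hc, map_mul, map_zsmul, map_zsmul]
        have := Polynomial.aeval_algHom_apply ((σ : K →ₐ[ℚ] K) : K →+* K).toIntAlgHom x g
        congr 2
        exact this.symm
  -- Subtracting `n` times the vanishing exponential sum leaves only the approximation errors.
  have hkey : ((a ^ (p * d) * n * N + p * M : ℤ) : ℂ) = -(D * a ^ (p * d) * ∑ x ∈ s,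
      φ (c x) * (n * Complex.exp (φ x) - p * φ (Polynomial.aeval x g))) := by
    have h1 : φ (c 0) + ∑ x ∈ s, φ (c x) * Complex.exp (φ x) = 0 := by
      rw [← hsum, Finsupp.sum, hs, ← Finset.add_sum_erase _ _ (Finsupp.mem_support_iff.mpr h0)]
      simp
    have h2 : (M : ℂ) = D * a ^ (p * d) * ∑ x ∈ s, φ (c x) * φ (Polynomial.aeval x g) := by
      rw [← map_intCast φ, hM, map_sum, Finset.mul_sum]
      refine Finset.sum_congr rfl fun x _ ↦ ?_
      simp only [zsmul_eq_mul, map_mul, map_intCast, Int.cast_pow, map_pow]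
      ring
    have h3 : (N : ℂ) = D * φ (c 0) := by
      rw [← map_intCast φ, hN, zsmul_eq_mul, map_mul, map_intCast]
    push_cast
    rw [h2, h3, eq_neg_of_add_eq_zero_left h1]
    simp only [mul_sub, Finset.sum_sub_distrib, mul_left_comm _ (n : ℂ), mul_left_comm _ (p : ℂ),
      ← Finset.mul_sum]
    ring
  have hnorm : ‖((a ^ (p * d) * n * N + p * M : ℤ) : ℂ)‖ < 1 := by
    rw [hkey, norm_neg, norm_mul, norm_mul, norm_pow, Complex.norm_intCast, Complex.norm_intCast]
    refine lt_of_le_of_lt ?_ hlt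
    have : ‖∑ x ∈ s, φ (c x) * (n * Complex.exp (φ x) - p * φ (Polynomial.aeval x g))‖ ≤
        (∑ x ∈ s, ‖φ (c x)‖) * (C ^ p / (p - 1).factorial) := by
      rw [Finset.sum_mul]
      refine norm_sum_le_of_le _ fun x hx ↦ ?_
      rw [norm_mul]
      exact mul_le_mul_of_nonneg_left (hg' x hx) (norm_nonneg _)
    calc _ ≤ |(D : ℝ)| * |(a : ℝ)| ^ (p * d) *
          ((∑ x ∈ s, ‖φ (c x)‖) * (C ^ p / (p - 1).factorial)) := by gcongr
      _ = _ := by rw [mul_comm p d, pow_mul]; ring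
  have hzero : a ^ (p * d) * n * N + p * M = 0 := by
    rw [Complex.norm_intCast] at hnorm
    exact Int.abs_lt_one_iff.mp (by exact_mod_cast hnorm)
  have hpZ : Prime (p : ℤ) := Nat.prime_iff_prime_int.mp hpp
  have hndvd {z : ℤ} (hz : z ≠ 0) (hzp : z.natAbs < p) : ¬ (p : ℤ) ∣ z := fun h ↦
    (Nat.le_of_dvd (Int.natAbs_pos.mpr hz) (Int.natCast_dvd.mp h)).not_gt hzp
  have hdvd : (p : ℤ) ∣ a ^ (p * d) * n * N :=
    ⟨-M, by linarith⟩
  rcases hpZ.dvd_or_dvd hdvd with h | h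
  · rcases hpZ.dvd_or_dvd h with h | h
    · exact hndvd ha0 hpa (hpZ.dvd_of_dvd_pow h)
    · exact hn h
  · exact hndvd hN0 hpN h

/-! ### The Hermite–Lindemann theorem -/

/-- The action of a Galois automorphism `σ` on finite formal sums `∑ c x • e^x`, with exponents and
coefficients both in `K`: it moves the exponents and the coefficients simultaneously, so it sends
`c • e^x` to `σ c • e^(σ x)`. The product of `K[K]` is that of formal exponentials. -/
noncomputable def galTwist {K : Type*} [Field K] [Algebra ℚ K] (σ : Gal(K/ℚ)) :
    AddMonoidAlgebra K K ≃+* AddMonoidAlgebra K K :=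
  (AddMonoidAlgebra.mapRingEquiv K (σ : K ≃+* K)).trans
    (AddMonoidAlgebra.mapDomainRingEquiv K (σ : K ≃+ K))

theorem galTwist_single {K : Type*} [Field K] [Algebra ℚ K] (σ : Gal(K/ℚ)) (x a : K) :
    galTwist σ (.single x a) = .single (σ x) (σ a) := by
  simp only [galTwist, RingEquiv.trans_apply, AddMonoidAlgebra.mapRingEquiv_single,
    AddMonoidAlgebra.mapDomainRingEquiv_single]
  rfl

theorem coeff_galTwist_apply {K : Type*} [Field K] [Algebra ℚ K] (σ : Gal(K/ℚ))
    (P : AddMonoidAlgebra K K) (x : K) :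
    (galTwist σ P).coeff (σ x) = σ (P.coeff x) := by
  simp [galTwist, Finsupp.equivMapDomain_apply]

theorem galTwist_mul_apply {K : Type*} [Field K] [Algebra ℚ K] (σ τ : Gal(K/ℚ))
    (P : AddMonoidAlgebra K K) :
    galTwist (σ * τ) P = galTwist σ (galTwist τ P) := by
  ext x
  obtain ⟨y, rfl⟩ := (σ * τ).surjective x
  rw [coeff_galTwist_apply, AlgEquiv.mul_apply, AlgEquiv.mul_apply, coeff_galTwist_apply,
    coeff_galTwist_apply]

/-- The value of a formal exponential sum: the symbol `e^x` becomes the complex number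
`exp (φ x)`, and coefficients are embedded by `φ`. -/
noncomputable def evalExp {K : Type*} [Field K] (φ : K →+* ℂ) : AddMonoidAlgebra K K →+* ℂ :=
  AddMonoidAlgebra.liftNCRingHom φ (Complex.expMonoidHom.comp φ.toAddMonoidHom.toMultiplicative)
    fun _ _ ↦ Commute.all _ _

theorem evalExp_single {K : Type*} [Field K] (φ : K →+* ℂ) (x a : K) :
    evalExp φ (.single x a) = φ a * Complex.exp (φ x) := by
  simp [evalExp, Complex.expMonoidHom]

theorem evalExp_eq_sum {K : Type*} [Field K] (φ : K →+* ℂ) (P : AddMonoidAlgebra K K) :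
    evalExp φ P = P.coeff.sum fun x a ↦ φ a * Complex.exp (φ x) := by
  conv_lhs => rw [← AddMonoidAlgebra.sum_coeff_single P]
  rw [Finsupp.sum, Finsupp.sum, map_sum]
  exact Finset.sum_congr rfl fun x _ ↦ evalExp_single φ x _

/-- In a Galois number field, no `b` embeds as the exponential of a nonzero `a`. Otherwise the
conjugates of `e^a - b • e^0` have a Galois-invariant product `F` of value `0`, and `F ≠ 0` because
`K[K]` is a domain. Translating a nonzero term of `F` to `e^0` and averaging over the Galois group
gives an invariant sum with nonzero constant term and still of value `0`. -/
theorem exp_ne_of_isGalois {K : Type*} [Field K] [NumberField K] [IsGalois ℚ K]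
    (φ : K →+* ℂ) {a : K} (ha : a ≠ 0) (b : K) : Complex.exp (φ a) ≠ φ b := by
  intro hexp
  let u (σ : Gal(K/ℚ)) : AddMonoidAlgebra K K := .single (σ a) 1 - .single 0 (σ b)
  have hu (σ) : u σ ≠ 0 := fun h ↦ by
    have := congrArg (fun P : AddMonoidAlgebra K K ↦ P.coeff (σ a)) h
    simp [u, ha] at this
  have hutwist (σ τ) : galTwist σ (u τ) = u (σ * τ) := by
    simp [u, galTwist_single]
  set F := ∏ σ, u σ with hF
  have hF0 : F ≠ 0 := Finset.prod_ne_zero_iff.mpr fun σ _ ↦ hu σ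
  have hFtwist (σ) : galTwist σ F = F := by
    rw [hF, map_prod]
    exact Fintype.prod_equiv (Equiv.mulLeft σ) _ _ fun τ ↦ hutwist σ τ
  have hFexp : evalExp φ F = 0 := by
    rw [hF, map_prod]
    -- The factor at the identity is `exp (φ a) - φ b`.
    refine Finset.prod_eq_zero (Finset.mem_univ 1) ?_
    simp [u, evalExp_single, hexp]
  obtain ⟨y, hy⟩ : ∃ y, F.coeff y ≠ 0 := by
    by_contra! h
    exact hF0 (AddMonoidAlgebra.ext (Finsupp.ext h))
  set Q := F * .single (-y) (F.coeff y)⁻¹ with hQ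
  have hQ0 : Q.coeff 0 = 1 := by
    have := AddMonoidAlgebra.coeff_mul_single_add F (F.coeff y)⁻¹ (-y) y
    rw [add_neg_cancel] at this
    rw [hQ, this, mul_inv_cancel₀ hy]
  set P := ∑ σ : Gal(K/ℚ), galTwist σ Q with hP
  have hPtwist (σ) : galTwist σ P = P := by
    rw [hP, map_sum]
    exact Fintype.sum_equiv (Equiv.mulLeft σ) _ _ fun τ ↦ (galTwist_mul_apply σ τ Q).symm
  have hPexp : evalExp φ P = 0 := by
    rw [hP, map_sum]
    refine Finset.sum_eq_zero fun σ _ ↦ ?_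
    -- Since `F` is invariant, it is a factor of every `galTwist σ Q`.
    rw [hQ, map_mul, hFtwist, map_mul, hFexp, zero_mul]
  have hP0 : P.coeff 0 = Fintype.card Gal(K/ℚ) := by
    have h (σ : Gal(K/ℚ)) : (galTwist σ Q).coeff 0 = 1 := by
      have := coeff_galTwist_apply σ Q 0
      rwa [map_zero, hQ0, map_one] at this
    rw [hP, AddMonoidAlgebra.coeff_sum, Finsupp.finsetSum_apply, Finset.sum_congr rfl fun σ _ ↦ h σ]
    simp
  have h := coeff_zero_eq_zero_of_sum_exp_eq_zero φ P.coeff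
    (fun σ x ↦ by rw [← coeff_galTwist_apply, hPtwist]) (by rw [← evalExp_eq_sum, hPexp])
  rw [hP0] at h
  exact Fintype.card_ne_zero (Nat.cast_eq_zero.mp h)

/-- **Hermite–Lindemann theorem**: the exponential of a nonzero algebraic number is
transcendental. -/
theorem transcendental_exp {a : ℂ} (ha : IsAlgebraic ℚ a) (ha0 : a ≠ 0) :
    Transcendental ℚ (Complex.exp a) := by
  intro hb
  have hai := ha.isIntegral
  have hbi := hb.isIntegral
  let f := minpoly ℚ a * minpoly ℚ (Complex.exp a)
  have hf0 : f ≠ 0 := mul_ne_zero (minpoly.ne_zero hai) (minpoly.ne_zero hbi)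
  let K := IntermediateField.adjoin ℚ (f.rootSet ℂ)
  have hsplit : f.IsSplittingField ℚ K :=
    IntermediateField.adjoin_rootSet_isSplittingField (IsAlgClosed.splits _)
  have : FiniteDimensional ℚ K := Polynomial.IsSplittingField.finiteDimensional K f
  have : NumberField K := ⟨⟩
  have : Normal ℚ K := Normal.of_isSplittingField f
  have : IsGalois ℚ K := ⟨⟩
  have haK : a ∈ K := IntermediateField.subset_adjoin _ _ <| by
    rw [Polynomial.mem_rootSet]
    exact ⟨hf0, by simp [f]⟩
  have hbK : Complex.exp a ∈ K := IntermediateField.subset_adjoin _ _ <| by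
    rw [Polynomial.mem_rootSet]
    exact ⟨hf0, by simp [f]⟩
  exact exp_ne_of_isGalois (algebraMap K ℂ) (a := ⟨a, haK⟩)
    (fun h ↦ ha0 (congrArg Subtype.val h)) ⟨_, hbK⟩ rfl

/-! ### The classical functions at algebraic points -/

theorem transcendental_cosh {z : ℂ} (hz : IsAlgebraic ℚ z) (hz0 : z ≠ 0) :
    Transcendental ℚ (Complex.cosh z) := by
  intro hc
  have hs : IsAlgebraic ℚ (Complex.sinh z) := by
    refine IsAlgebraic.of_pow two_pos ?_
    rw [Complex.sinh_sq]
    exact (hc.pow 2).sub isAlgebraic_one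
  refine transcendental_exp hz hz0 ?_
  rw [← Complex.cosh_add_sinh]
  exact hc.add hs

theorem transcendental_sinh {z : ℂ} (hz : IsAlgebraic ℚ z) (hz0 : z ≠ 0) :
    Transcendental ℚ (Complex.sinh z) := by
  intro hs
  refine transcendental_cosh hz hz0 (IsAlgebraic.of_pow two_pos ?_)
  rw [Complex.cosh_sq]
  exact (hs.pow 2).add isAlgebraic_one

theorem transcendental_sinh_div_cosh {z : ℂ} (hz : IsAlgebraic ℚ z) (hz0 : z ≠ 0)
    (hcosh : Complex.cosh z ≠ 0) : Transcendental ℚ (Complex.sinh z / Complex.cosh z) := by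
  intro ht
  refine transcendental_cosh hz hz0 (IsAlgebraic.of_pow two_pos ?_)
  have h : Complex.cosh z ^ 2 = (1 - (Complex.sinh z / Complex.cosh z) ^ 2)⁻¹ := by
    rw [div_pow, one_sub_div (pow_ne_zero 2 hcosh), Complex.cosh_sq_sub_sinh_sq, one_div, inv_inv]
  rw [h]
  exact (isAlgebraic_one.sub (ht.pow 2)).inv

theorem isAlgebraic_complex_I : IsAlgebraic ℚ Complex.I :=
  IsAlgebraic.of_pow two_pos (by rw [Complex.I_sq]; exact isAlgebraic_one.neg)

theorem transcendental_cos {z : ℂ} (hz : IsAlgebraic ℚ z) (hz0 : z ≠ 0) :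
    Transcendental ℚ (Complex.cos z) := by
  rw [← Complex.cosh_mul_I]
  exact transcendental_cosh (hz.mul isAlgebraic_complex_I) (mul_ne_zero hz0 Complex.I_ne_zero)

theorem transcendental_sin {z : ℂ} (hz : IsAlgebraic ℚ z) (hz0 : z ≠ 0) :
    Transcendental ℚ (Complex.sin z) := by
  intro hs
  refine transcendental_sinh (hz.mul isAlgebraic_complex_I) (mul_ne_zero hz0 Complex.I_ne_zero) ?_
  rw [Complex.sinh_mul_I]
  exact hs.mul isAlgebraic_complex_I

theorem transcendental_sin_div_cos {z : ℂ} (hz : IsAlgebraic ℚ z) (hz0 : z ≠ 0)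
    (hcos : Complex.cos z ≠ 0) : Transcendental ℚ (Complex.sin z / Complex.cos z) := by
  intro ht
  rw [← Complex.cosh_mul_I] at hcos
  refine transcendental_sinh_div_cosh (hz.mul isAlgebraic_complex_I)
    (mul_ne_zero hz0 Complex.I_ne_zero) hcos ?_
  rw [Complex.sinh_mul_I, Complex.cosh_mul_I, mul_div_right_comm]
  exact ht.mul isAlgebraic_complex_I

theorem transcendental_log {z : ℂ} (hz : IsAlgebraic ℚ z) (hz0 : z ≠ 0) (hz1 : z ≠ 1) :
    Transcendental ℚ (Complex.log z) := by
  intro hl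
  have hl0 : Complex.log z ≠ 0 := fun h ↦ hz1 (by rw [← Complex.exp_log hz0, h, Complex.exp_zero])
  refine transcendental_exp hl hl0 ?_
  rwa [Complex.exp_log hz0]

theorem ClassicalFun.transcendental_eval (f : ClassicalFun) {z : ℂ} (hz : IsAlgebraic ℚ z)
    (hdom : z ∈ f.domain) (hz0 : z ≠ 0) (hln : f = ClassicalFun.ln → z ≠ 1) :
    Transcendental ℚ (f.eval z) := by
  cases f with
  | exp => exact transcendental_exp hz hz0
  | ln => exact transcendental_log hz hz0 (hln rfl)
  | sin => exact transcendental_sin hz hz0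
  | cos => exact transcendental_cos hz hz0
  | tan => exact transcendental_sin_div_cos hz hz0 hdom
  | csc => exact fun h ↦ transcendental_sin hz hz0 (by simpa [eval] using h.inv)
  | sec => exact fun h ↦ transcendental_cos hz hz0 (by simpa [eval] using h.inv)
  | cot =>
    intro h
    -- `tan z` is only the inverse of `cot z` where `cos z ≠ 0`; a zero of `cos` is not algebraic.
    have hcos : Complex.cos z ≠ 0 := fun h0 ↦ transcendental_cos hz hz0 (h0 ▸ isAlgebraic_zero)
    exact transcendental_sin_div_cos hz hz0 hcos (by simpa [eval] using h.inv)
  | sinh => exact transcendental_sinh hz hz0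
  | cosh => exact transcendental_cosh hz hz0
  | tanh => exact transcendental_sinh_div_cosh hz hz0 hdom
  | coth =>
    intro h
    have hcosh : Complex.cosh z ≠ 0 := fun h0 ↦ transcendental_cosh hz hz0 (h0 ▸ isAlgebraic_zero)
    exact transcendental_sinh_div_cosh hz hz0 hcosh (by simpa [eval] using h.inv)

theorem theorem2 (f : ClassicalFun) (g h₁ h₂ : ℚ[X]) (α : ℂ)
    (hdom : Polynomial.aeval α g ∈ f.domain)
    (hzero : Polynomial.aeval α h₁ * f.eval (Polynomial.aeval α g) = Polynomial.aeval α h₂)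
    (hh₁ : Polynomial.aeval α h₁ ≠ 0)
    (hg : Polynomial.aeval α g ≠ 0)
    (hln : f = ClassicalFun.ln → Polynomial.aeval α g ≠ 1) :
    Transcendental ℚ α := by
  intro hα
  have halg (q : ℚ[X]) : IsAlgebraic ℚ (Polynomial.aeval α q) :=
    (IsIntegral.of_mem_of_fg _ hα.isIntegral.fg_adjoin_singleton _
      (Polynomial.aeval_mem_adjoin_singleton ℚ α)).isAlgebraic
  refine f.transcendental_eval (halg g) hdom hg hln ?_
  rw [eq_div_of_mul_eq hh₁ ((mul_comm _ _).trans hzero), div_eq_mul_inv]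
  exact (halg h₂).mul (halg h₁).inv
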